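/- Let $p$ be a prime, $n\ge 1$, $N=p^n$, let $R$ be a commutative $\mathbb F_p$-algebra and $\lambda\in R$. For a commutative $\mathbb F_p$-algebra $R'$ and $\mu\in R'$ put $Y_s=\sum_{k=0}^{s}\binom{s}{k}\mu^kX_{T^k}$ in $R'[X_1,X_T,\dots,X_{T^{N-1}}]$, where $X_1=X_{T^0}$ and $X_{T^k}=0$ for $k\ge N$, and let $$S(A_{R'}^{(\mu)})_\Theta=R'\Bigl[X_1,X_T,\dots,X_{T^{N-1}},\tfrac1\varDelta\Bigr],\qquad \varDelta=\prod_{l=0}^{N-1}Y_l .$$ Let $A_R^{(\lambda)}=R[T]/(T^{N})$ be the Hopf algebra with comultiplication $T\mapsto T\otimes1+1\otimes T+\lambda T\otimes T$. The comultiplication of $S(A_R^{(\lambda)})_\Theta$ is the algebra map with $$X_{T^s}\mapsto\sum_{l=0}^{s}\binom sl\Bigl(\sum_{k=0}^{l}\binom lk\lambda^kX_{T^{k+s-l}}\Bigr)\otimes X_{T^l}\qquad(0\le s\le N-1),$$ and $S(A_R^{(\lambda)})_\Theta$ is a right $A_R^{(\lambda)}$-comodule algebra by $\rho=(\mathrm{id}\otimes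 j^\#)\circ(\text{comultiplication})$, where $j^\#:S(A_R^{(\lambda)})_\Theta\to A_R^{(\lambda)}$, $X_{T^s}\mapsto T^s$. Let $S(A_R^{(\lambda)})_\Theta^{\mathrm{co}A_R^{(\lambda)}}=\{a:\rho(a)=a\otimes1\}$. Over $R'=R[\Lambda,1/\Lambda]$ with $\mu=\Lambda$ define recursively, for $2\le s\le N$, $$P_{(\Lambda)}(X_T^s)=\frac1{\Lambda^s}\Bigl\{\frac{(X_1+\Lambda X_T)^sX_1}{\sum_{k=0}^{s}\binom sk\Lambda^kX_{T^k}}-X_1^s-\sum_{k=2}^{s-1}\binom sk\Lambda^kX_1^{s-k}P_{(\Lambda)}(X_T^k)\Bigr\}\in S(A^{(\Lambda)}_{R[\Lambda,1/\Lambda]})_\Theta .$$ Then for $2\le s\le N$ the element $P_{(\Lambda)}(X_T^s)$ is the image of exactly one element of $S(A^{(\Lambda)}_{R[\Lambda]})_\Theta$; let $P_{(\lambda)}(X_T^s)\in S(A_R^{(\lambda)})_\Theta$ be the image of the latter under $\Lambda\mapsto\lambda$. Moreover, $S(A_R^{(\lambda)})_\Theta^{\mathrm{co}A_R^{(\lambda)}}$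 is the $R$-subalgebra of $S(A_R^{(\lambda)})_\Theta$ generated by $X_1^{\pm1}$, $X_T^{p^n}$, $P_{(\lambda)}(X_T^s)$ for $2\le s\le p^n$, $1/(X_1^{p^n}+\lambda^{p^n}X_T^{p^n})$, and $$\frac{\sum_{k=0}^{s}\binom sk\lambda^kX_{T^k}}{(X_1+\lambda X_T)^s}\qquad\text{for }2\le s\le p^n-1 .$$ -/

import Mathlib

open scoped TensorProduct

namespace UnitGroupScheme

noncomputable section

section Ring

variable {R : Type*} [CommRing R] (lam : R) (N : ℕ)

/-- The variable `X_{T^s}` of `R[X_1, X_T, …, X_{T^{N-1}}]`, with `X_{T^s} = 0` for `s ≥ N`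
(as `T^s = 0` in `R[T]/(T^N)`). Here `X_1 = X_{T^0}`. -/
def polyX (R : Type*) [CommRing R] (N s : ℕ) : MvPolynomial (Fin N) R :=
  if h : s < N then MvPolynomial.X ⟨s, h⟩ else 0

/-- `∑_{k=0}^{s} binom(s,k) λ^k X_{T^k}`. -/
def polyY (s : ℕ) : MvPolynomial (Fin N) R :=
  ∑ k ∈ Finset.range (s + 1), (s.choose k : MvPolynomial (Fin N) R) *
    MvPolynomial.C (lam ^ k) * polyX R N k

/-- The determinant `∏_{l=0}^{N-1} ∑_{k=0}^{l} binom(l,k) λ^k X_{T^k}`. -/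
def disc : MvPolynomial (Fin N) R :=
  ∏ l ∈ Finset.range N, polyY lam N l

/-- `S(A_R^{(λ)})_Θ = R[X_1, X_T, …, X_{T^{N-1}}, 1/Δ]`, with `N = p ^ n`. -/
abbrev SA : Type _ := Localization.Away (disc lam N)

/-- The algebra `A_R^{(λ)} = R[T]/(T^N)`, with `N = p ^ n`. As an algebra it does not depend on `λ`;
its Hopf algebra structure enters through the coaction below. -/
abbrev TruncPoly (R : Type*) [CommRing R] (N : ℕ) : Type _ :=
  Polynomial R ⧸ Ideal.span {(Polynomial.X ^ N : Polynomial R)}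

/-- The class of `T` in `R[T]/(T^N)`. -/
def truncT (R : Type*) [CommRing R] (N : ℕ) : TruncPoly R N :=
  Ideal.Quotient.mk _ Polynomial.X

/-- The element `X_{T^s}` of `S(A_R^{(λ)})_Θ`. -/
def X (s : ℕ) : SA lam N := algebraMap (MvPolynomial (Fin N) R) (SA lam N) (polyX R N s)

/-- The element `∑_{k=0}^{s} binom(s,k) λ^k X_{T^k}` of `S(A_R^{(λ)})_Θ`. -/
def Y (s : ℕ) : SA lam N :=
  ∑ k ∈ Finset.range (s + 1), (s.choose k : SA lam N) * algebraMap R (SA lam N) (lam ^ k) *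
    X lam N k

lemma algebraMap_polyY (s : ℕ) :
    algebraMap (MvPolynomial (Fin N) R) (SA lam N) (polyY lam N s) = Y lam N s := by
  simp only [polyY, Y, X, map_sum, map_mul, map_natCast]
  refine Finset.sum_congr rfl fun k _ => ?_
  rw [IsScalarTower.algebraMap_apply R (MvPolynomial (Fin N) R) (SA lam N),
    MvPolynomial.algebraMap_eq]

lemma disc_eq : disc lam N = ∏ l ∈ Finset.range N, polyY lam N l := rfl

lemma isUnit_disc : IsUnit (algebraMap (MvPolynomial (Fin N) R) (SA lam N) (disc lam N)) :=
  IsLocalization.Away.algebraMap_isUnit _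

lemma isUnit_Y {s : ℕ} (hs : s < N) : IsUnit (Y lam N s) := by
  rw [← algebraMap_polyY]
  refine isUnit_of_dvd_unit (map_dvd _ ?_) (isUnit_disc lam N)
  exact Finset.dvd_prod_of_mem _ (Finset.mem_range.2 hs)

/-- The comultiplication of `S(A_R^{(λ)})_Θ` on `X_{T^s}`:
`∑_l binom(s,l) (∑_k binom(l,k) λ^k X_{T^{k+s-l}}) ⊗ X_{T^l}`. -/
def comulX (s : ℕ) : SA lam N ⊗[R] SA lam N :=
  ∑ l ∈ Finset.range (s + 1), (s.choose l : SA lam N ⊗[R] SA lam N) *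
    ((∑ k ∈ Finset.range (l + 1), (l.choose k : SA lam N) * algebraMap R (SA lam N) (lam ^ k) *
      X lam N (k + (s - l))) ⊗ₜ[R] X lam N l)

/-- The comultiplication on the polynomial ring `R[X_1, X_T, …, X_{T^{N-1}}]`. -/
def comulPoly : MvPolynomial (Fin N) R →ₐ[R] SA lam N ⊗[R] SA lam N :=
  MvPolynomial.aeval fun s => comulX lam N s

/-- The `R`-linear map `R[T] → S(A_R^{(λ)})_Θ`, `T^s ↦ X_{T^s}`. -/
def linX : Polynomial R →ₗ[R] SA lam N :=
  Polynomial.lsum fun s => LinearMap.toSpanSingleton R (SA lam N) (X lam N s)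

lemma linX_X_pow (s : ℕ) : linX lam N (Polynomial.X ^ s) = X lam N s := by
  rw [← Polynomial.monomial_one_right_eq_X_pow]
  simp [linX, Polynomial.lsum_apply, Polynomial.sum_monomial_index]

lemma linX_pow (s m : ℕ) :
    linX lam N (Polynomial.X ^ m * (1 + Polynomial.C lam * Polynomial.X) ^ s) =
      ∑ k ∈ Finset.range (s + 1), (s.choose k : SA lam N) * algebraMap R (SA lam N) (lam ^ k) *
        X lam N (k + m) := by
  rw [add_comm (1 : Polynomial R), add_pow, Finset.mul_sum, map_sum]
  refine Finset.sum_congr rfl fun k _ => ?_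
  have : (Polynomial.X ^ m * ((Polynomial.C lam * Polynomial.X) ^ k * 1 ^ (s - k) *
      (s.choose k : Polynomial R)) : Polynomial R) =
      ((s.choose k : R) * lam ^ k) • Polynomial.X ^ (k + m) := by
    rw [Polynomial.smul_eq_C_mul]
    simp only [map_mul, map_natCast, map_pow]
    ring
  rw [this, map_smul, linX_X_pow, Algebra.smul_def, map_mul, map_natCast]

lemma comulX_eq (s : ℕ) :
    comulX lam N s = TensorProduct.map (linX lam N) (linX lam N)
      ((Polynomial.X ⊗ₜ[R] 1 + (1 + Polynomial.C lam * Polynomial.X) ⊗ₜ[R] Polynomial.X) ^ s) := by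
  rw [add_comm (Polynomial.X ⊗ₜ[R] (1 : Polynomial R)), add_pow, map_sum, comulX]
  refine Finset.sum_congr rfl fun l _ => ?_
  have := linX_pow lam N l (s - l)
  rw [← this, mul_comm _ ((s.choose l : ℕ) : Polynomial R ⊗[R] Polynomial R),
    ← nsmul_eq_mul, ← nsmul_eq_mul, map_nsmul, Algebra.TensorProduct.tmul_pow,
    Algebra.TensorProduct.tmul_pow, Algebra.TensorProduct.tmul_mul_tmul, TensorProduct.map_tmul,
    one_pow, mul_one, linX_X_pow, mul_comm (Polynomial.X ^ (s - l))]

lemma comulPoly_polyX {s : ℕ} (hs : s < N) : comulPoly lam N (polyX R N s) = comulX lam N s := by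
  simp [comulPoly, polyX, hs]

lemma comulPoly_polyY {s : ℕ} (hs : s < N) :
    comulPoly lam N (polyY lam N s) = Y lam N s ⊗ₜ[R] Y lam N s := by
  have hY : Y lam N s = linX lam N ((1 + Polynomial.C lam * Polynomial.X) ^ s) := by
    have := linX_pow lam N s 0
    simpa [Y] using this.symm
  have key : ((1 + Polynomial.C lam * Polynomial.X) ^ s) ⊗ₜ[R]
      ((1 + Polynomial.C lam * Polynomial.X) ^ s) =
      (1 + lam • (Polynomial.X ⊗ₜ[R] 1 +
        (1 + Polynomial.C lam * Polynomial.X) ⊗ₜ[R] Polynomial.X) :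
          Polynomial R ⊗[R] Polynomial R) ^ s := by
    rw [← Algebra.TensorProduct.tmul_pow]
    congr 1
    rw [TensorProduct.tmul_add, ← Polynomial.smul_eq_C_mul, TensorProduct.tmul_smul, smul_add,
      TensorProduct.add_tmul, Algebra.TensorProduct.one_def, TensorProduct.smul_tmul',
      TensorProduct.smul_tmul', add_assoc]
  rw [hY, ← TensorProduct.map_tmul, key, add_comm (1 : Polynomial R ⊗[R] Polynomial R), add_pow,
    map_sum, polyY, map_sum]
  refine Finset.sum_congr rfl fun k hk => ?_
  have hkN : k < N := by
    have := Finset.mem_range.1 hk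
    omega
  rw [map_mul, map_mul, map_natCast, comulPoly_polyX lam N hkN, comulX_eq, one_pow, mul_one,
    mul_comm _ ((s.choose k : ℕ) : Polynomial R ⊗[R] Polynomial R), mul_assoc, ← nsmul_eq_mul,
    ← nsmul_eq_mul, map_nsmul, smul_pow, map_smul, ← MvPolynomial.algebraMap_eq,
    AlgHom.commutes, ← Algebra.smul_def]

lemma isUnit_comulPoly_disc : IsUnit (comulPoly lam N (disc lam N)) := by
  have h0 := congrArg (comulPoly lam N) (disc_eq lam N)
  rw [map_prod] at h0
  rw [h0, IsUnit.prod_iff]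
  intro s hs
  have hs := Finset.mem_range.1 hs
  rw [comulPoly_polyY lam N hs]
  have h := isUnit_Y lam N hs
  have h1 : IsUnit (Y lam N s ⊗ₜ[R] (1 : SA lam N)) :=
    h.map (Algebra.TensorProduct.includeLeft : SA lam N →ₐ[R] SA lam N ⊗[R] SA lam N)
  have h2 : IsUnit ((1 : SA lam N) ⊗ₜ[R] Y lam N s) :=
    h.map (Algebra.TensorProduct.includeRight : SA lam N →ₐ[R] SA lam N ⊗[R] SA lam N)
  simpa using h1.mul h2

/-- The comultiplication of `S(A_R^{(λ)})_Θ`. -/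
def comul : SA lam N →ₐ[R] SA lam N ⊗[R] SA lam N :=
  IsLocalization.liftAlgHom (M := Submonoid.powers (disc lam N)) (f := comulPoly lam N) (by
    rintro ⟨_, m, rfl⟩
    simpa using (isUnit_comulPoly_disc lam N).pow m)

/-- The map `R[X_1, X_T, …, X_{T^{N-1}}] → R[T]/(T^N)`, `X_{T^s} ↦ T^s`. -/
def immersionPoly (R : Type*) [CommRing R] (N : ℕ) :
    MvPolynomial (Fin N) R →ₐ[R] TruncPoly R N :=
  MvPolynomial.aeval fun s => truncT R N ^ (s : ℕ)

lemma isUnit_immersionPoly_disc : IsUnit (immersionPoly R N (disc lam N)) := by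
  have hT : truncT R N ^ N = 0 := by
    rw [truncT, ← map_pow, Ideal.Quotient.eq_zero_iff_mem]
    exact Ideal.subset_span rfl
  have hu : IsUnit (1 + algebraMap R (TruncPoly R N) lam * truncT R N) := by
    refine IsNilpotent.isUnit_one_add ⟨N, ?_⟩
    rw [mul_pow, hT, mul_zero]
  have h0 := congrArg (immersionPoly R N) (disc_eq lam N)
  rw [map_prod] at h0
  rw [h0, IsUnit.prod_iff]
  intro s hs
  have hs := Finset.mem_range.1 hs
  suffices h : immersionPoly R N (polyY lam N s) =
      (1 + algebraMap R (TruncPoly R N) lam * truncT R N) ^ s by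
    rw [h]
    exact hu.pow s
  rw [add_comm, add_pow, polyY, map_sum]
  refine Finset.sum_congr rfl fun k hk => ?_
  have hkN : k < N := by
    have := Finset.mem_range.1 hk
    omega
  have hX : immersionPoly R N (polyX R N k) = truncT R N ^ k := by
    simp [immersionPoly, polyX, hkN]
  rw [map_mul, map_mul, map_natCast, hX, ← MvPolynomial.algebraMap_eq, AlgHom.commutes, map_pow]
  ring

/-- The map `j^# : S(A_R^{(λ)})_Θ → A_R^{(λ)}`, `X_{T^s} ↦ T^s`, of the closed immersion of
`Γ^{(λ)}` into `U(Γ^{(λ)})`. -/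
def immersion : SA lam N →ₐ[R] TruncPoly R N :=
  IsLocalization.liftAlgHom (M := Submonoid.powers (disc lam N)) (f := immersionPoly R N) (by
    rintro ⟨_, m, rfl⟩
    simpa using (isUnit_immersionPoly_disc lam N).pow m)

/-- The right coaction `ρ = (id ⊗ j^#) ∘ Δ` of `A_R^{(λ)}` on `S(A_R^{(λ)})_Θ`. -/
def coaction : SA lam N →ₐ[R] SA lam N ⊗[R] TruncPoly R N :=
  (Algebra.TensorProduct.map (AlgHom.id R (SA lam N)) (immersion lam N)).comp (comul lam N)

/-- The coinvariants `{a | ρ(a) = a ⊗ 1}`. -/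
def coinvariants : Subalgebra R (SA lam N) :=
  AlgHom.equalizer (coaction lam N) Algebra.TensorProduct.includeLeft

end Ring

section BaseChange

variable {R R' : Type*} [CommRing R] [CommRing R'] (f : R →+* R') {lam : R} {lam' : R'} (N : ℕ)

lemma map_polyX (s : ℕ) : MvPolynomial.map f (polyX R N s) = polyX R' N s := by
  unfold polyX
  split_ifs <;> simp

lemma map_disc (h : f lam = lam') : MvPolynomial.map f (disc lam N) = disc lam' N := by
  simp [disc, polyY, map_polyX, map_prod, map_sum, h]

/-- The map `S(A_R^{(λ)})_Θ → S(A_{R'}^{(λ')})_Θ`, `X_{T^s} ↦ X_{T^s}`, induced by a ring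
homomorphism `f : R → R'` with `f(λ) = λ'`. -/
def baseChange (h : f lam = lam') : SA lam N →+* SA lam' N :=
  IsLocalization.Away.lift (disc lam N)
    (g := (algebraMap (MvPolynomial (Fin N) R') (SA lam' N)).comp (MvPolynomial.map f)) (by
      rw [RingHom.comp_apply, map_disc f N h]
      exact isUnit_disc lam' N)

end BaseChange

section P

variable (R : Type*) [CommRing R] (N : ℕ)

/-- `S(A^{(Λ)})_Θ` over `R[Λ]`. -/
abbrev SAPoly : Type _ := SA (Polynomial.X : Polynomial R) N

/-- `S(A^{(Λ)})_Θ` over `R[Λ, 1/Λ]`. -/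
abbrev SALaurent : Type _ := SA (LaurentPolynomial.T 1 : LaurentPolynomial R) N

/-- The natural map from `S(A^{(Λ)})_Θ` over `R[Λ]` to the one over `R[Λ, 1/Λ]`. -/
def toSALaurent : SAPoly R N →+* SALaurent R N :=
  baseChange (Polynomial.toLaurent (R := R)) N Polynomial.toLaurent_X

variable {R} in
/-- The specialization `Λ ↦ λ`, from `S(A^{(Λ)})_Θ` over `R[Λ]` to `S(A_R^{(λ)})_Θ`. -/
def specialize (lam : R) : SAPoly R N →+* SA lam N :=
  baseChange (Polynomial.evalRingHom lam) N (Polynomial.eval_X)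

/-- The element `P_{(Λ)}(X_T^s)`, `s ≥ 2`, of `S(A^{(Λ)})_Θ` over `R[Λ, 1/Λ]`:
`Λ^{-s} { (X_1 + Λ X_T)^s X_1 / ∑_{k=0}^{s} binom(s,k) Λ^k X_{T^k} - X_1^s
  - ∑_{k=2}^{s-1} binom(s,k) Λ^k X_1^{s-k} P_{(Λ)}(X_T^k) }`. -/
def laurentP (s : ℕ) : SALaurent R N :=
  algebraMap (LaurentPolynomial R) (SALaurent R N) (LaurentPolynomial.T (-(s : ℤ))) *
    ((X (LaurentPolynomial.T 1) N 0 +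
          algebraMap (LaurentPolynomial R) (SALaurent R N) (LaurentPolynomial.T 1) *
            X (LaurentPolynomial.T 1) N 1) ^ s *
        X (LaurentPolynomial.T 1) N 0 * Ring.inverse (Y (LaurentPolynomial.T 1) N s) -
      X (LaurentPolynomial.T 1) N 0 ^ s -
      ∑ k ∈ (Finset.Ico 2 s).attach, (s.choose k : SALaurent R N) *
        algebraMap (LaurentPolynomial R) (SALaurent R N) (LaurentPolynomial.T (k : ℤ)) *
        X (LaurentPolynomial.T 1) N 0 ^ (s - (k : ℕ)) * laurentP k)
  termination_by s
  decreasing_by exact (Finset.mem_Ico.1 k.2).2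

open Classical in
/-- The element `P_{(λ)}(X_T^s)` of `S(A_R^{(λ)})_Θ`: the element `P_{(Λ)}(X_T^s)`, which lies in
`S(A^{(Λ)})_Θ` over `R[Λ]`, specialized at `Λ = λ`. (The value `0` is a placeholder for the case
that `P_{(Λ)}(X_T^s)` does not lie there.) -/
def P {R : Type*} [CommRing R] (lam : R) (N s : ℕ) : SA lam N :=
  if h : ∃ q : SAPoly R N, toSALaurent R N q = laurentP R N s then
    specialize N lam h.choose
  else 0

/-- The `R`-subalgebra of `S(A_R^{(λ)})_Θ` generated by `X_1^{±1}`, `X_T^N`,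
`P_{(λ)}(X_T^s)` for `2 ≤ s ≤ N`, `1/(X_1^N + λ^N X_T^N)` and
`(∑_{k=0}^{s} binom(s,k) λ^k X_{T^k}) / (X_1 + λ X_T)^s` for `2 ≤ s ≤ N - 1`. -/
def generated {R : Type*} [CommRing R] (lam : R) (N : ℕ) : Subalgebra R (SA lam N) :=
  Algebra.adjoin R
    ({X lam N 0, Ring.inverse (X lam N 0), X lam N 1 ^ N,
        Ring.inverse (X lam N 0 ^ N + algebraMap R (SA lam N) (lam ^ N) * X lam N 1 ^ N)} ∪
      {x | ∃ s, 2 ≤ s ∧ s ≤ N ∧ x = P lam N s} ∪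
      {x | ∃ s, 2 ≤ s ∧ s < N ∧ x = Y lam N s *
        Ring.inverse ((X lam N 0 + algebraMap R (SA lam N) lam * X lam N 1) ^ s)})

end P

end

end UnitGroupScheme

namespace UnitGroupScheme

noncomputable section

/-! Write `N = p^n`, `X k` for `X_{T^k}` (so `X 0` is the statement's `X_1`), and `B` for
`generated`. The argument rests on elements `recP s` given by a recursion that never divides by `λ`:
`∑ binom(s,i) (X 0)^(s-i) recP i · shiftY i (s-i) = X 0 · (X 1)^s`, where `recP s` has the unit
coefficient `Y s`. Summing over `s` gives `Y s · ∑ binom(s,k) λ^k (X 0)^(s-k) recP k = X 0 · (Y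
1)^s` (`Y_mul_sum_recP`). When `Λ` is invertible this is the recursion for `P_{(Λ)}`, so `recP s`
over `R[Λ]` is the required lift; it is unique because `R[Λ] → R[Λ, 1/Λ]` stays injective on the
algebras `S`.

`B` is coinvariant: `ρ` multiplies `Y s` by `(1 + λT)^s`, so it fixes `X 0 · (Y 1)^s / Y s`. By
induction it fixes `Λ^s recP s`, and `Λ^s` can be cancelled over `R[Λ]` before specializing.

Conversely, `B` and `x = X 1` generate the whole algebra (`generated_closure_eq_top`), and `x^N ∈
B`, so every element is `q(x)` with `q` over `B` and `deg q < N`. Since `ρ(x) = x + Y 1 · T`,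
coinvariance of `q(x)` says that `q(x + Y 1 · T)` is constant modulo `T^N`. The degree bound makes
this an identity of polynomials, and `Y 1` is a unit, so `q` is constant and `q(x) ∈ B`. -/

lemma map_ringInverse {A B : Type*} [CommRing A] [CommRing B] (f : A →+* B) {a : A}
    (ha : IsUnit a) : f (Ring.inverse a) = Ring.inverse (f a) := by
  refine ((ha.map f).mul_right_inj).1 ?_
  rw [Ring.mul_inverse_cancel _ (ha.map f), ← map_mul, Ring.mul_inverse_cancel _ ha, map_one]

lemma add_pow_of_choose_eq_zero {A : Type*} [CommRing A] {N : ℕ} (hN0 : 0 < N)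
    (hN : ∀ k, 0 < k → k < N → (N.choose k : A) = 0) (x y : A) :
    (x + y) ^ N = x ^ N + y ^ N := by
  obtain ⟨m, rfl⟩ : ∃ m, N = m + 1 := ⟨N - 1, by omega⟩
  rw [add_pow, Finset.sum_range_succ, Finset.sum_range_succ', Finset.sum_eq_zero]
  · simp [add_comm]
  · intro k hk
    rw [hN (k + 1) (by omega) (by have := Finset.mem_range.1 hk; omega), mul_zero]

/-! ### The division-free recursion for `P`. -/

section Ring

variable {R : Type*} [CommRing R] (lam : R) (N : ℕ)

/-- The element `∑_{j=0}^{i} binom(i,j) λ^j X_{T^{j+k}}`, the image of `T^k (1 + λ T)^i` under the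
linear map `T^s ↦ X_{T^s}`. -/
def shiftY (i k : ℕ) : SA lam N :=
  ∑ j ∈ Finset.range (i + 1), (i.choose j : SA lam N) * algebraMap R (SA lam N) (lam ^ j) *
    X lam N (j + k)

lemma shiftY_eq_linX (i k : ℕ) : shiftY lam N i k =
    linX lam N (Polynomial.X ^ k * (1 + Polynomial.C lam * Polynomial.X) ^ i) :=
  (linX_pow lam N i k).symm

lemma shiftY_zero_right (s : ℕ) : shiftY lam N s 0 = Y lam N s := rfl

lemma shiftY_zero_left (s : ℕ) : shiftY lam N 0 s = X lam N s := by simp [shiftY]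

lemma Y_zero : Y lam N 0 = X lam N 0 := by simp [Y]

lemma Y_one : Y lam N 1 = X lam N 0 + algebraMap R (SA lam N) lam * X lam N 1 := by
  simp [Y, Finset.sum_range_succ]

lemma X_of_le {s : ℕ} (hs : N ≤ s) : X lam N s = 0 := by
  simp [X, polyX, Nat.not_lt.2 hs]

lemma choose_cast_eq_zero {A : Type*} [CommRing A] [Algebra R A]
    (hN : ∀ k, 0 < k → k < N → (N.choose k : R) = 0) (k : ℕ) (hk : 0 < k) (hkN : k < N) :
    (N.choose k : A) = 0 := by
  rw [← map_natCast (algebraMap R A), hN k hk hkN, map_zero]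

/-- The middle binomials vanish, and the top term dies because `X_{T^N} = 0`. Hence `Y N`, which is
not a factor of `disc`, is still a unit, and the index `s = N` can be treated with the others. -/
lemma Y_self (hN : ∀ k, 0 < k → k < N → (N.choose k : R) = 0) : Y lam N N = X lam N 0 := by
  rw [Y, Finset.sum_range_succ', Finset.sum_eq_zero]
  · simp
  · intro k hk
    rcases (Nat.succ_le_of_lt (Finset.mem_range.1 hk)).lt_or_eq with h | h
    · rw [choose_cast_eq_zero N hN (k + 1) (by omega) h]
      simp
    · rw [X_of_le lam N (s := k + 1) h.ge, mul_zero]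

lemma isUnit_Y_of_le (hN0 : 0 < N) (hN : ∀ k, 0 < k → k < N → (N.choose k : R) = 0) {s : ℕ}
    (hs : s ≤ N) : IsUnit (Y lam N s) := by
  rcases hs.lt_or_eq with h | rfl
  · exact isUnit_Y lam N h
  · rw [Y_self lam s hN, ← Y_zero]
    exact isUnit_Y lam s hN0

/-- The decomposition of `(1 + λ T)^(i + t)` along powers of `T (1 + λ T)^i`. -/
lemma Y_add (i t : ℕ) : Y lam N (i + t) =
    ∑ r ∈ Finset.range (t + 1), (t.choose r : SA lam N) * algebraMap R (SA lam N) (lam ^ r) *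
      shiftY lam N i r := by
  have h : (Polynomial.X ^ 0 * (1 + Polynomial.C lam * Polynomial.X) ^ (i + t) : Polynomial R) =
      ∑ r ∈ Finset.range (t + 1), ((t.choose r : R) * lam ^ r) •
        (Polynomial.X ^ r * (1 + Polynomial.C lam * Polynomial.X) ^ i) := by
    rw [pow_zero, one_mul, pow_add, add_comm (1 : Polynomial R), add_pow _ _ t, Finset.mul_sum]
    refine Finset.sum_congr rfl fun r _ => ?_
    rw [Polynomial.smul_eq_C_mul]
    simp only [map_mul, map_natCast, map_pow, one_pow]
    ring
  rw [← shiftY_zero_right, shiftY_eq_linX, h, map_sum]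
  refine Finset.sum_congr rfl fun r _ => ?_
  rw [map_smul, ← shiftY_eq_linX, Algebra.smul_def, map_mul, map_natCast]

/-- A description of `P_{(λ)}(X_T^s)` by a recursion that does not divide by `λ`. -/
def recP (s : ℕ) : SA lam N :=
  Ring.inverse (Y lam N s) * (X lam N 0 * X lam N 1 ^ s -
    ∑ i : Fin s, (s.choose i : SA lam N) * X lam N 0 ^ (s - (i : ℕ)) * recP i *
      shiftY lam N i (s - i))
  termination_by s

variable {N}

lemma sum_recP_mul_shiftY {s : ℕ} (hs : IsUnit (Y lam N s)) :
    ∑ i ∈ Finset.range (s + 1), (s.choose i : SA lam N) * X lam N 0 ^ (s - i) * recP lam N i *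
      shiftY lam N i (s - i) = X lam N 0 * X lam N 1 ^ s := by
  rw [Finset.sum_range_succ, recP.eq_def lam N s, Nat.sub_self, shiftY_zero_right, Nat.choose_self,
    Finset.sum_range (fun i => (s.choose i : SA lam N) * X lam N 0 ^ (s - i) * recP lam N i *
      shiftY lam N i (s - i))]
  have := Ring.inverse_mul_cancel _ hs
  linear_combination (X lam N 0 * X lam N 1 ^ s - ∑ i : Fin s, (s.choose i : SA lam N) *
    X lam N 0 ^ (s - (i : ℕ)) * recP lam N i * shiftY lam N i (s - i)) * this

lemma recP_zero (h : IsUnit (Y lam N 0)) : recP lam N 0 = 1 := by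
  rw [recP]
  simp only [Y_zero] at h ⊢
  simp [Ring.inverse_mul_cancel _ h]

/-- The two terms `X 0 * X 1` cancel. This is why the recursion for `P` may start at index 2. -/
lemma recP_one (h : IsUnit (Y lam N 0)) : recP lam N 1 = 0 := by
  rw [recP]
  simp [recP_zero lam h, shiftY_zero_left]

/-- Expand `(Y 1)^s = (X 0 + λ X 1)^s`, replace each `X 0 * X 1 ^ m` by the recursion, and exchange
the sums. With `binom(s,m) binom(m,i) = binom(s,i) binom(s-i,m-i)`, the inner sum over `m` is the
expansion `Y_add` of `Y s`. -/
lemma Y_mul_sum_recP (s : ℕ) (hs : ∀ m ≤ s, IsUnit (Y lam N m)) :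
    Y lam N s * ∑ k ∈ Finset.range (s + 1), (s.choose k : SA lam N) *
      algebraMap R (SA lam N) (lam ^ k) * X lam N 0 ^ (s - k) * recP lam N k =
    X lam N 0 * Y lam N 1 ^ s := by
  have hR : X lam N 0 * Y lam N 1 ^ s = ∑ m ∈ Finset.range (s + 1), ∑ i ∈ Finset.range (m + 1),
      ((s.choose m * m.choose i : ℕ) : SA lam N) * algebraMap R (SA lam N) (lam ^ m) *
        X lam N 0 ^ (s - m + (m - i)) * recP lam N i * shiftY lam N i (m - i) := by
    rw [Y_one, add_comm, add_pow, Finset.mul_sum]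
    refine Finset.sum_congr rfl fun m hm => ?_
    have h := sum_recP_mul_shiftY lam (hs m (by have := Finset.mem_range.1 hm; omega))
    have h' : X lam N 0 * ((algebraMap R (SA lam N) lam * X lam N 1) ^ m * X lam N 0 ^ (s - m) *
        (s.choose m : SA lam N)) = (s.choose m : SA lam N) * algebraMap R (SA lam N) (lam ^ m) *
          X lam N 0 ^ (s - m) * (X lam N 0 * X lam N 1 ^ m) := by
      rw [map_pow]; ring
    rw [h', ← h, Finset.mul_sum]
    refine Finset.sum_congr rfl fun i _ => ?_
    rw [pow_add, Nat.cast_mul]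
    ring
  rw [hR, Finset.sum_comm' (t' := Finset.range (s + 1)) (s' := fun i => Finset.Ico i (s + 1)),
    Finset.mul_sum]
  · refine Finset.sum_congr rfl fun i hi => ?_
    have hi : i ≤ s := by have := Finset.mem_range.1 hi; omega
    obtain ⟨t, rfl⟩ := Nat.exists_eq_add_of_le hi
    rw [Y_add, Finset.sum_mul, Finset.sum_Ico_eq_sum_range, show i + t + 1 - i = t + 1 by omega]
    refine Finset.sum_congr rfl fun r hr => ?_
    have hr : r ≤ t := by have := Finset.mem_range.1 hr; omega
    rw [Nat.choose_mul (by omega : i ≤ i + r), show i + t - i = t by omega,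
      show i + r - i = r by omega, show i + t - (i + r) + r = t by omega, pow_add, map_mul,
      Nat.cast_mul]
    ring
  · intro m i
    simp only [Finset.mem_range, Finset.mem_Ico]
    omega

end Ring

/-! ### Compatibility with base change. -/

section BaseChange

variable {R R' : Type*} [CommRing R] [CommRing R'] (f : R →+* R') {lam : R} {lam' : R'} {N : ℕ}
  (h : f lam = lam')

lemma baseChange_algebraMap_poly (a : MvPolynomial (Fin N) R) :
    baseChange f N h (algebraMap _ _ a) = algebraMap _ _ (MvPolynomial.map f a) :=
  IsLocalization.Away.lift_eq _ _ _

lemma baseChange_algebraMap (a : R) :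
    baseChange f N h (algebraMap R _ a) = algebraMap R' _ (f a) := by
  rw [IsScalarTower.algebraMap_apply R (MvPolynomial (Fin N) R), baseChange_algebraMap_poly,
    MvPolynomial.algebraMap_eq, MvPolynomial.map_C, ← MvPolynomial.algebraMap_eq,
    ← IsScalarTower.algebraMap_apply]

lemma baseChange_X (s : ℕ) : baseChange f N h (X lam N s) = X lam' N s := by
  rw [X, baseChange_algebraMap_poly, map_polyX, X]

lemma baseChange_shiftY (i k : ℕ) :
    baseChange f N h (shiftY lam N i k) = shiftY lam' N i k := by
  simp only [shiftY, map_sum, map_mul, map_natCast, baseChange_X, baseChange_algebraMap, map_pow, h]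

lemma baseChange_Y (s : ℕ) : baseChange f N h (Y lam N s) = Y lam' N s := by
  rw [← shiftY_zero_right, baseChange_shiftY, shiftY_zero_right]

lemma baseChange_recP {s : ℕ} (hs : ∀ m ≤ s, IsUnit (Y lam N m)) :
    baseChange f N h (recP lam N s) = recP lam' N s := by
  induction s using Nat.strong_induction_on with
  | _ s ih =>
    rw [recP, recP.eq_def lam', map_mul, map_ringInverse _ (hs s le_rfl), baseChange_Y, map_sub,
      map_mul, map_pow, map_sum, baseChange_X, baseChange_X]
    congr 2
    refine Finset.sum_congr rfl fun i _ => ?_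
    rw [map_mul, map_mul, map_mul, map_natCast, map_pow, baseChange_X, baseChange_shiftY,
      ih i i.2 fun m hm => hs m (hm.trans i.2.le)]

/-- `disc` need not be known to be regular: if a power of it kills the image of a numerator, the
same power already kills the numerator, because `f` is injective on coefficients. -/
lemma baseChange_injective (hf : Function.Injective f) :
    Function.Injective (baseChange f N h) := by
  rw [injective_iff_map_eq_zero]
  intro a ha
  obtain ⟨⟨x, ⟨_, m, rfl⟩⟩, hx⟩ := IsLocalization.surj (Submonoid.powers (disc lam N)) a
  have hx0 : algebraMap _ (SA lam' N) (MvPolynomial.map f x) = 0 := by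
    rw [← baseChange_algebraMap_poly f h, ← hx, map_mul, ha, zero_mul]
  rw [IsLocalization.map_eq_zero_iff (Submonoid.powers (disc lam' N))] at hx0
  obtain ⟨⟨_, k, rfl⟩, hk⟩ := hx0
  have hx1 : disc lam N ^ k * x = 0 := by
    apply MvPolynomial.map_injective f hf
    rw [map_mul, map_pow, map_disc f N h, map_zero]
    exact hk
  have hu := isUnit_disc lam N
  have hx2 : algebraMap _ (SA lam N) x = 0 := by
    have := congrArg (algebraMap _ (SA lam N)) hx1
    rw [map_mul, map_pow, map_zero] at this
    exact (hu.pow k).mul_right_eq_zero.1 this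
  rw [hx2] at hx
  refine (hu.pow m).mul_left_eq_zero.1 ?_
  rw [← map_pow]
  exact hx

end BaseChange

/-! ### Identification of `P` with `recP`. -/

section P

variable (R : Type*) [CommRing R] {N : ℕ}

/-- Solving `Y_mul_sum_recP` for its term `k = s`, where `Λ^s` is invertible, gives the defining
recursion of `laurentP`: the term `k = 0` is `X 0 ^ s` and the term `k = 1` is zero. -/
lemma laurentP_eq_recP (s : ℕ) (hs : 2 ≤ s)
    (hu : ∀ m ≤ s, IsUnit (Y (LaurentPolynomial.T 1 : LaurentPolynomial R) N m)) :
    laurentP R N s = recP (LaurentPolynomial.T 1) N s := by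
  induction s using Nat.strong_induction_on with
  | _ s ih =>
    have hT (k : ℕ) : (LaurentPolynomial.T 1 : LaurentPolynomial R) ^ k =
        LaurentPolynomial.T (k : ℤ) := by simp [LaurentPolynomial.T_pow]
    have key := Y_mul_sum_recP (LaurentPolynomial.T 1 : LaurentPolynomial R) s hu
    have hsplit : ∀ F : ℕ → SALaurent R N, ∑ k ∈ Finset.range (s + 1), F k =
        F 0 + F 1 + ∑ k ∈ Finset.Ico 2 s, F k + F s := by
      intro F
      rw [Finset.sum_range_succ, Finset.range_eq_Ico, Finset.sum_eq_sum_Ico_succ_bot (by omega),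
        Finset.sum_eq_sum_Ico_succ_bot (by omega)]
      simp only [zero_add, Nat.reduceAdd]
      ring
    rw [hsplit] at key
    simp only [hT] at key
    have h0 := hu 0 (by omega)
    rw [recP_zero _ h0, recP_one _ h0] at key
    have hinv : algebraMap (LaurentPolynomial R) (SALaurent R N) (LaurentPolynomial.T (-(s : ℤ))) *
        algebraMap (LaurentPolynomial R) (SALaurent R N) (LaurentPolynomial.T (s : ℤ)) = 1 := by
      rw [← map_mul, ← LaurentPolynomial.T_add]
      simp
    have hsum : ∑ k ∈ (Finset.Ico 2 s).attach, (s.choose k : SALaurent R N) *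
        algebraMap (LaurentPolynomial R) (SALaurent R N) (LaurentPolynomial.T ((k : ℕ) : ℤ)) *
        X (LaurentPolynomial.T 1) N 0 ^ (s - (k : ℕ)) * laurentP R N k =
        ∑ k ∈ Finset.Ico 2 s, (s.choose k : SALaurent R N) *
        algebraMap (LaurentPolynomial R) (SALaurent R N) (LaurentPolynomial.T (k : ℤ)) *
        X (LaurentPolynomial.T 1) N 0 ^ (s - k) * recP (LaurentPolynomial.T 1) N k := by
      rw [← Finset.sum_attach (Finset.Ico 2 s)]
      refine Finset.sum_congr rfl fun k _ => ?_
      have hk := Finset.mem_Ico.1 k.2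
      rw [ih k hk.2 hk.1 fun m hm => hu m (hm.trans hk.2.le)]
    rw [laurentP, hsum, ← Y_one]
    have hY := Ring.inverse_mul_cancel _ (hu s le_rfl)
    simp only [Nat.choose_zero_right, Nat.choose_self, Nat.sub_self, pow_zero, mul_one, mul_zero,
      Nat.cast_one, one_mul, Nat.cast_zero, LaurentPolynomial.T_zero, map_one, Nat.sub_zero,
      add_zero] at key
    -- What remains is a ring identity with `y` inverse to `z` and `a` inverse to `b`; opaque
    -- letters keep it small.
    generalize ∑ k ∈ Finset.Ico 2 s, (s.choose k : SALaurent R N) *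
        algebraMap (LaurentPolynomial R) (SALaurent R N) (LaurentPolynomial.T (k : ℤ)) *
        X (LaurentPolynomial.T 1) N 0 ^ (s - k) * recP (LaurentPolynomial.T 1) N k = Q at *
    generalize algebraMap (LaurentPolynomial R) (SALaurent R N) (LaurentPolynomial.T (-(s : ℤ))) = a
      at *
    generalize algebraMap (LaurentPolynomial R) (SALaurent R N) (LaurentPolynomial.T (s : ℤ)) = b
      at *
    generalize Ring.inverse (Y (LaurentPolynomial.T 1 : LaurentPolynomial R) N s) = y at *
    generalize Y (LaurentPolynomial.T 1 : LaurentPolynomial R) N s = z at *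
    generalize recP (LaurentPolynomial.T 1 : LaurentPolynomial R) N s = w at *
    generalize X (LaurentPolynomial.T 1 : LaurentPolynomial R) N 0 ^ s = v at *
    linear_combination (-a * y) * key + a * (v + Q + b * w) * hY + w * hinv

lemma toSALaurent_recP {s : ℕ} (hu : ∀ m ≤ s, IsUnit (Y (Polynomial.X : Polynomial R) N m)) :
    toSALaurent R N (recP Polynomial.X N s) = recP (LaurentPolynomial.T 1) N s :=
  baseChange_recP _ _ hu

lemma toSALaurent_injective : Function.Injective (toSALaurent R N) :=
  baseChange_injective _ _ Polynomial.toLaurent_injective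

lemma toSALaurent_recP_eq_laurentP (hN0 : 0 < N)
    (hN : ∀ k, 0 < k → k < N → (N.choose k : R) = 0) {s : ℕ} (hs : 2 ≤ s) (hsN : s ≤ N) :
    toSALaurent R N (recP Polynomial.X N s) = laurentP R N s := by
  rw [toSALaurent_recP, laurentP_eq_recP R s hs]
  · exact fun m hm => isUnit_Y_of_le _ N hN0 (choose_cast_eq_zero N hN) (hm.trans hsN)
  · exact fun m hm => isUnit_Y_of_le _ N hN0 (choose_cast_eq_zero N hN) (hm.trans hsN)

/-- Injectivity of `toSALaurent` forces the chosen preimage to be `recP` over `R[Λ]`, which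
specializes to `recP` over `R`. -/
lemma P_eq_recP {R : Type*} [CommRing R] (lam : R) (hN0 : 0 < N)
    (hN : ∀ k, 0 < k → k < N → (N.choose k : R) = 0) {s : ℕ} (hs : 2 ≤ s) (hsN : s ≤ N) :
    P lam N s = recP lam N s := by
  have hrec := toSALaurent_recP_eq_laurentP R hN0 hN hs hsN
  have h : ∃ q : SAPoly R N, toSALaurent R N q = laurentP R N s := ⟨_, hrec⟩
  rw [P, dif_pos h, toSALaurent_injective R (h.choose_spec.trans hrec.symm)]
  exact baseChange_recP _ _
    fun m hm => isUnit_Y_of_le _ N hN0 (choose_cast_eq_zero N hN) (hm.trans hsN)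

end P

/-! ### Truncated polynomials and the tensor product. -/

section Trunc

variable {R A B : Type*} [CommRing R] [CommRing A] [CommRing B] (N : ℕ)

lemma truncT_pow_self : truncT R N ^ N = 0 := by
  rw [truncT, ← map_pow, Ideal.Quotient.eq_zero_iff_mem]
  exact Ideal.subset_span rfl

lemma truncMk_eq_zero_iff (q : Polynomial A) :
    (Ideal.Quotient.mk (Ideal.span {(Polynomial.X ^ N : Polynomial A)}) q : TruncPoly A N) = 0 ↔
      ∀ d < N, q.coeff d = 0 := by
  rw [Ideal.Quotient.eq_zero_iff_mem, Ideal.mem_span_singleton, Polynomial.X_pow_dvd_iff]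

lemma algebraMap_trunc (a : A) : algebraMap A (TruncPoly A N) a =
    Ideal.Quotient.mk _ (Polynomial.C a) := rfl

lemma isSMulRegular_trunc {a : A} (ha : ∀ b : A, a * b = 0 → b = 0) (x : TruncPoly A N)
    (hx : algebraMap A (TruncPoly A N) a * x = 0) : x = 0 := by
  obtain ⟨q, rfl⟩ := Ideal.Quotient.mk_surjective x
  rw [algebraMap_trunc, ← map_mul, truncMk_eq_zero_iff] at hx
  rw [truncMk_eq_zero_iff]
  intro d hd
  have := hx d hd
  rw [Polynomial.coeff_C_mul] at this
  exact ha _ this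

/-- The map `A[T]/(T^N) → B[T]/(T^N)` induced by a ring homomorphism `A → B`. -/
def truncMap (f : A →+* B) : TruncPoly A N →+* TruncPoly B N :=
  Ideal.quotientMap _ (Polynomial.mapRingHom f) (by
    rw [Ideal.span_le, Set.singleton_subset_iff, SetLike.mem_coe, Ideal.mem_comap]
    refine Ideal.subset_span ?_
    simp)

lemma truncMap_mk (f : A →+* B) (q : Polynomial A) :
    truncMap N f (Ideal.Quotient.mk _ q) = Ideal.Quotient.mk _ (q.map f) := rfl

lemma truncMap_algebraMap (f : A →+* B) (a : A) :
    truncMap N f (algebraMap A _ a) = algebraMap B _ (f a) := by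
  rw [algebraMap_trunc, truncMap_mk, Polynomial.map_C, algebraMap_trunc]

lemma truncMap_truncT (f : A →+* B) : truncMap N f (truncT A N) = truncT B N := by
  rw [truncT, truncMap_mk, Polynomial.map_X, truncT]

variable (R A) [Algebra R A]

/-- The map `R[T]/(T^N) → A[T]/(T^N)` for an `R`-algebra `A`. -/
def truncMapₐ : TruncPoly R N →ₐ[R] TruncPoly A N where
  __ := truncMap N (algebraMap R A)
  commutes' r := by
    refine (truncMap_algebraMap N (algebraMap R A) r).trans ?_
    rw [← IsScalarTower.algebraMap_apply]

/-- The natural map `A ⊗ R[T]/(T^N) → A[T]/(T^N)`. -/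
def tensorTrunc : A ⊗[R] TruncPoly R N →ₐ[A] TruncPoly A N :=
  Algebra.TensorProduct.lift (Algebra.ofId A _) (truncMapₐ R A N) fun _ _ => Commute.all _ _

variable {A}

lemma tensorTrunc_tmul (a : A) (x : TruncPoly R N) :
    tensorTrunc R A N (a ⊗ₜ x) = algebraMap A _ a * truncMap N (algebraMap R A) x := rfl

/-- The map `T ↦ 1 ⊗ T` is a left inverse. -/
lemma tensorTrunc_injective : Function.Injective (tensorTrunc R A N) := by
  let T' : A ⊗[R] TruncPoly R N := 1 ⊗ₜ truncT R N
  have hT' : T' ^ N = 0 := by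
    rw [Algebra.TensorProduct.tmul_pow, truncT_pow_self, TensorProduct.tmul_zero]
  let g : TruncPoly A N →ₐ[A] A ⊗[R] TruncPoly R N :=
    Ideal.Quotient.liftₐ _ (Polynomial.aeval T') (by
      intro q hq
      obtain ⟨r, rfl⟩ := Ideal.mem_span_singleton.1 hq
      rw [map_mul, Polynomial.aeval_X_pow, hT']
      exact MulZeroClass.zero_mul (M₀ := A ⊗[R] TruncPoly R N) _)
  have hg : g (truncT A N) = T' := Polynomial.aeval_X T'
  have h : g.comp (tensorTrunc R A N) = AlgHom.id A _ := by
    refine Algebra.TensorProduct.ext_ring (Ideal.Quotient.algHom_ext R (Polynomial.algHom_ext ?_))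
    change g (tensorTrunc R A N (1 ⊗ₜ truncT R N)) = T'
    rw [tensorTrunc_tmul, truncMap_truncT, map_one, one_mul, hg]
  exact Function.LeftInverse.injective (AlgHom.congr_fun h)

end Trunc

/-! ### The coaction on `X`, `Y` and `recP`. -/

section Coaction

variable {R : Type*} [CommRing R] (lam : R) (N : ℕ)

/-- The coaction with values in `S(A_R^{(λ)})_Θ[T]/(T^N)`. -/
def truncCoaction : SA lam N →ₐ[R] TruncPoly (SA lam N) N :=
  ((tensorTrunc R (SA lam N) N).restrictScalars R).comp (coaction lam N)

/-- Turns coinvariance into an equation in `S[T]/(T^N)`, where coefficients of powers of `T` can be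
compared. -/
lemma mem_coinvariants_iff (a : SA lam N) :
    a ∈ coinvariants lam N ↔ truncCoaction lam N a = algebraMap _ _ a := by
  have h : tensorTrunc R (SA lam N) N (a ⊗ₜ 1) = algebraMap _ _ a := by
    rw [tensorTrunc_tmul, map_one, mul_one]
  rw [coinvariants, AlgHom.mem_equalizer, ← h]
  exact (tensorTrunc_injective R N).eq_iff.symm

lemma comul_algebraMap (q : MvPolynomial (Fin N) R) :
    comul lam N (algebraMap _ _ q) = comulPoly lam N q :=
  IsLocalization.lift_eq _ _

lemma immersion_X {s : ℕ} (hs : s < N) : immersion lam N (X lam N s) = truncT R N ^ s := by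
  have : immersion lam N (X lam N s) = immersionPoly R N (polyX R N s) :=
    IsLocalization.lift_eq _ _
  rw [this]
  simp [immersionPoly, polyX, hs]

lemma immersion_Y {s : ℕ} (hs : s < N) :
    immersion lam N (Y lam N s) = (1 + algebraMap R _ lam * truncT R N) ^ s := by
  rw [add_comm, add_pow, Y, map_sum]
  refine Finset.sum_congr rfl fun k hk => ?_
  have hkN : k < N := by
    have := Finset.mem_range.1 hk
    omega
  rw [map_mul, map_mul, map_natCast, immersion_X lam N hkN, AlgHom.commutes, map_pow]
  ring

lemma truncCoaction_X {s : ℕ} (hs : s < N) : truncCoaction lam N (X lam N s) =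
    ∑ l ∈ Finset.range (s + 1), (s.choose l : TruncPoly (SA lam N) N) *
      (algebraMap _ _ (shiftY lam N l (s - l)) * truncT (SA lam N) N ^ l) := by
  rw [truncCoaction, AlgHom.comp_apply, coaction, AlgHom.comp_apply, X, comul_algebraMap,
    comulPoly_polyX lam N hs, comulX, map_sum, map_sum]
  refine Finset.sum_congr rfl fun l hl => ?_
  have hlN : l < N := by
    have := Finset.mem_range.1 hl
    omega
  rw [map_mul, map_natCast, map_mul, map_natCast, Algebra.TensorProduct.map_tmul,
    immersion_X lam N hlN, AlgHom.restrictScalars_apply, tensorTrunc_tmul, map_pow,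
    truncMap_truncT]
  rfl

/-- `Y s` is group-like, and `j^#` sends it to `(1 + λT)^s`. -/
lemma truncCoaction_Y {s : ℕ} (hs : s < N) : truncCoaction lam N (Y lam N s) =
    algebraMap _ _ (Y lam N s) *
      (1 + algebraMap R (TruncPoly (SA lam N) N) lam * truncT (SA lam N) N) ^ s := by
  rw [truncCoaction, AlgHom.comp_apply, coaction, AlgHom.comp_apply, ← algebraMap_polyY,
    comul_algebraMap, comulPoly_polyY lam N hs, algebraMap_polyY, Algebra.TensorProduct.map_tmul,
    immersion_Y lam N hs, AlgHom.restrictScalars_apply, tensorTrunc_tmul, map_pow, map_add,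
    map_mul, map_one, truncMap_truncT, truncMap_algebraMap, ← IsScalarTower.algebraMap_apply]
  rfl

lemma truncCoaction_X_zero (hN : 0 < N) :
    truncCoaction lam N (X lam N 0) = algebraMap _ _ (X lam N 0) := by
  rw [← Y_zero, truncCoaction_Y lam N hN, pow_zero, mul_one]

lemma truncCoaction_X_one (hN : 1 < N) : truncCoaction lam N (X lam N 1) =
    algebraMap _ _ (X lam N 1) + algebraMap _ _ (Y lam N 1) * truncT (SA lam N) N := by
  rw [truncCoaction_X lam N hN]
  simp [Finset.sum_range_succ, shiftY_zero_left, shiftY_zero_right]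

lemma isUnit_one_add_truncT {A : Type*} [CommRing A] (a : A) :
    IsUnit (1 + algebraMap A _ a * truncT A N) := by
  refine IsNilpotent.isUnit_one_add ⟨N, ?_⟩
  rw [mul_pow, truncT_pow_self, mul_zero]

lemma one_add_truncT_eq : 1 + algebraMap R (TruncPoly (SA lam N) N) lam * truncT (SA lam N) N =
    1 + algebraMap (SA lam N) _ (algebraMap R _ lam) * truncT (SA lam N) N := by
  rw [← IsScalarTower.algebraMap_apply]

lemma truncCoaction_Y_of_le (hN0 : 0 < N) (hN : ∀ k, 0 < k → k < N → (N.choose k : R) = 0) {s : ℕ}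
    (hs : s ≤ N) : truncCoaction lam N (Y lam N s) = algebraMap _ _ (Y lam N s) *
      (1 + algebraMap R (TruncPoly (SA lam N) N) lam * truncT (SA lam N) N) ^ s := by
  rcases hs.lt_or_eq with h | rfl
  · exact truncCoaction_Y lam N h
  -- For `s = N` both sides are `X 0`, since `(1 + λT)^N = 1 + λ^N T^N = 1`.
  · rw [add_pow_of_choose_eq_zero hN0 (choose_cast_eq_zero s hN), mul_pow, truncT_pow_self,
      Y_self lam s hN, truncCoaction_X_zero lam s hN0]
    simp

/-- Checked on constants and variables. It carries coinvariance from `R[Λ]` to `R`. -/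
lemma truncCoaction_baseChange {R' : Type*} [CommRing R'] (f : R →+* R') {lam' : R'}
    (h : f lam = lam') (a : SA lam N) : truncCoaction lam' N (baseChange f N h a) =
      truncMap N (baseChange f N h) (truncCoaction lam N a) := by
  have : (truncCoaction lam' N).toRingHom.comp (baseChange f N h) =
      (truncMap N (baseChange f N h)).comp (truncCoaction lam N).toRingHom := by
    refine IsLocalization.ringHom_ext (Submonoid.powers (disc lam N)) ?_
    refine MvPolynomial.ringHom_ext (fun r => ?_) fun s => ?_
    · have hr : algebraMap (MvPolynomial (Fin N) R) (SA lam N) (MvPolynomial.C r) =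
          algebraMap R _ r := by
        rw [IsScalarTower.algebraMap_apply R (MvPolynomial (Fin N) R)]; rfl
      simp only [RingHom.comp_apply, hr]
      rw [baseChange_algebraMap]
      refine (AlgHom.commutes (truncCoaction lam' N) _).trans ?_
      refine Eq.trans ?_ (congrArg _ (AlgHom.commutes (truncCoaction lam N) _).symm)
      rw [IsScalarTower.algebraMap_apply R (SA lam N), truncMap_algebraMap, baseChange_algebraMap,
        ← IsScalarTower.algebraMap_apply]
    · have hX : algebraMap (MvPolynomial (Fin N) R) (SA lam N) (MvPolynomial.X s) =
          X lam N s := by simp [X, polyX]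
      simp only [RingHom.comp_apply, hX]
      rw [baseChange_X]
      refine (truncCoaction_X lam' N s.2).trans ?_
      refine Eq.trans ?_ (congrArg _ (truncCoaction_X lam N s.2).symm)
      simp only [map_sum, map_mul, map_natCast, map_pow, truncMap_truncT, truncMap_algebraMap,
        baseChange_shiftY]
  exact RingHom.congr_fun this a

/-- The sum in `Y_mul_sum_recP` equals `X 0 * Y 1 ^ s / Y s` and is coinvariant. By induction so are
its terms below `s`, hence also `λ^s * recP s`; regularity of `λ` removes the power. -/
lemma recP_coinvariant_of_regular (hN0 : 1 < N)
    (hN : ∀ k, 0 < k → k < N → (N.choose k : R) = 0)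
    (hreg : ∀ b : SA lam N, algebraMap R _ lam * b = 0 → b = 0) {s : ℕ} (hs : s ≤ N) :
    truncCoaction lam N (recP lam N s) = algebraMap _ _ (recP lam N s) := by
  have hN1 : 0 < N := by omega
  induction s using Nat.strong_induction_on with
  | _ s ih =>
    set u := 1 + algebraMap R (TruncPoly (SA lam N) N) lam * truncT (SA lam N) N with hu
    have huu : IsUnit u := by
      rw [hu, one_add_truncT_eq]
      exact isUnit_one_add_truncT N _
    have key := Y_mul_sum_recP lam s fun m hm => isUnit_Y_of_le lam N hN1 hN (hm.trans hs)
    have key1 := congrArg (truncCoaction lam N) key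
    -- Both sides pick up the same factor `u ^ s`, a unit; it is cancelled, and then `Y s`.
    rw [map_mul, map_mul, map_pow, truncCoaction_Y_of_le lam N hN1 hN hs, truncCoaction_Y lam N hN0,
      truncCoaction_X_zero lam N hN1, pow_one, mul_pow, ← mul_assoc, ← map_pow, ← map_mul, ← key,
      map_mul, mul_right_comm, (huu.pow s).mul_left_inj,
      ((isUnit_Y_of_le lam N hN1 hN hs).map _).mul_right_inj, Finset.sum_range_succ,
      map_add, map_add] at key1
    have hsum : truncCoaction lam N (∑ k ∈ Finset.range s, (s.choose k : SA lam N) *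
          algebraMap R (SA lam N) (lam ^ k) * X lam N 0 ^ (s - k) * recP lam N k) =
        algebraMap (SA lam N) (TruncPoly (SA lam N) N) (∑ k ∈ Finset.range s,
          (s.choose k : SA lam N) * algebraMap R (SA lam N) (lam ^ k) * X lam N 0 ^ (s - k) *
            recP lam N k) := by
      rw [map_sum, map_sum]
      refine Finset.sum_congr rfl fun k hk => ?_
      have hk := Finset.mem_range.1 hk
      rw [map_mul, map_mul, map_mul, map_natCast, AlgHom.commutes,
        map_pow (truncCoaction lam N), truncCoaction_X_zero lam N hN1, ih k hk (hk.le.trans hs),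
        IsScalarTower.algebraMap_apply R (SA lam N)]
      simp only [map_mul, map_natCast, map_pow]
    rw [hsum, add_right_inj, Nat.choose_self, Nat.sub_self, pow_zero, mul_one, Nat.cast_one,
      one_mul, map_mul, map_mul, AlgHom.commutes, IsScalarTower.algebraMap_apply R (SA lam N),
      ← sub_eq_zero, ← mul_sub] at key1
    refine sub_eq_zero.1 (isSMulRegular_trunc N ?_ _ key1)
    clear * - hreg
    intro b hb
    rw [map_pow] at hb
    induction s with
    | zero => simpa using hb
    | succ s ih => exact ih (hreg _ (by rw [← hb]; ring))

/-- `Λ` becomes a unit after the injective passage to `R[Λ, 1/Λ]`. -/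
lemma polyX_regular (b : SAPoly R N)
    (hb : algebraMap (Polynomial R) (SAPoly R N) Polynomial.X * b = 0) : b = 0 := by
  apply toSALaurent_injective R
  have h := congrArg (toSALaurent R N) hb
  rw [map_mul, map_zero, toSALaurent, baseChange_algebraMap, Polynomial.toLaurent_X] at h
  rw [map_zero]
  have hu : IsUnit (LaurentPolynomial.T 1 : LaurentPolynomial R) := LaurentPolynomial.isUnit_T 1
  exact (hu.map _).mul_right_eq_zero.1 h

/-- `λ` itself may be zero or a zero divisor, so the claim is proved for `Λ` over `R[Λ]` and then
specialized. -/
lemma recP_mem_coinvariants (hN0 : 1 < N) (hN : ∀ k, 0 < k → k < N → (N.choose k : R) = 0) {s : ℕ}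
    (hs : s ≤ N) : recP lam N s ∈ coinvariants lam N := by
  have hlam : Polynomial.evalRingHom lam Polynomial.X = lam := Polynomial.eval_X
  rw [mem_coinvariants_iff, ← baseChange_recP (Polynomial.evalRingHom lam) hlam
    (s := s) fun m hm => isUnit_Y_of_le _ N (by omega) (choose_cast_eq_zero N hN) (hm.trans hs),
    truncCoaction_baseChange, recP_coinvariant_of_regular _ N hN0 (choose_cast_eq_zero N hN)
    (polyX_regular N) hs, truncMap_algebraMap]

end Coaction

/-! ### Polynomials of degree below `N` in one generator. -/

/-- The hypothesis `h` says `S = B[x]`. Division by the monic polynomial `X^N - x^N` over `B`, which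
vanishes at `x`, lowers the degree. -/
lemma exists_polynomial_of_forall_eq_top {R S : Type*} [CommRing R] [CommRing S] [Algebra R S]
    {B : Subalgebra R S} {x : S} {N : ℕ} (hN : 0 < N) (hx : x ^ N ∈ B)
    (h : ∀ E : Subalgebra R S, B ≤ E → x ∈ E → E = ⊤) (a : S) :
    ∃ q : Polynomial S, (∀ k, q.coeff k ∈ B) ∧ q.degree < N ∧ q.eval x = a := by
  nontriviality S
  have hE := h ((Algebra.adjoin B {x}).restrictScalars R)
    (fun b hb => Subalgebra.algebraMap_mem (Algebra.adjoin B {x}) ⟨b, hb⟩)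
    (Algebra.subset_adjoin (R := B) (s := {x}) rfl)
  have ha : a ∈ Algebra.adjoin B {x} := by
    rw [← Subalgebra.mem_restrictScalars R, hE]
    exact Algebra.mem_top
  rw [Algebra.adjoin_singleton_eq_range_aeval] at ha
  obtain ⟨q, rfl⟩ := ha
  let M : Polynomial B := Polynomial.X ^ N - Polynomial.C ⟨x ^ N, hx⟩
  have hM : M.Monic := Polynomial.monic_X_pow_sub_C _ hN.ne'
  have hMev : Polynomial.aeval x M = 0 := by
    simp only [M, map_sub, map_pow, Polynomial.aeval_X, Polynomial.aeval_C]
    exact sub_self _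
  refine ⟨(q %ₘ M).map (algebraMap _ _), fun k => ?_, ?_, ?_⟩
  · rw [Polynomial.coeff_map]
    exact ((q %ₘ M).coeff k).2
  · refine Polynomial.degree_map_le.trans_lt ((Polynomial.degree_modByMonic_lt q hM).trans_eq ?_)
    exact Polynomial.degree_X_pow_sub_C hN _
  · rw [Polynomial.eval_map_algebraMap]
    conv_rhs => rw [AlgHom.toRingHom_eq_coe, RingHom.coe_coe,
      ← Polynomial.modByMonic_add_div q M, map_add, map_mul, hMev, zero_mul, add_zero]

/-- A ring homomorphism `σ : S → S[T]/(T^N)` with `σ(x) = x + y T`, `y` a unit, fixes an element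
`q(x)` with `σ`-fixed coefficients and `deg q < N` only if `q` is constant. -/
lemma eq_C_of_truncPoly_hom {S : Type*} [CommRing S] {N : ℕ} (σ : S →+* TruncPoly S N)
    (hN : 0 < N) {x y : S} (hy : IsUnit y)
    (hx : σ x = algebraMap S _ x + algebraMap S _ y * truncT S N) {q : Polynomial S}
    (hdeg : q.degree < N) (hq : ∀ k, σ (q.coeff k) = algebraMap S _ (q.coeff k))
    (ha : σ (q.eval x) = algebraMap S _ (q.eval x)) : q = Polynomial.C (q.eval x) := by
  -- `ℓ` lifts `σ x` to `S[T]`; `ℓ'` inverts it under composition, as `y` is a unit.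
  let ℓ : Polynomial S := Polynomial.C x + Polynomial.C y * Polynomial.X
  let ℓ' : Polynomial S := Polynomial.C (Ring.inverse y) * (Polynomial.X - Polynomial.C x)
  have hℓ : ℓ.comp ℓ' = Polynomial.X := by
    simp only [ℓ, ℓ', Polynomial.add_comp, Polynomial.mul_comp, Polynomial.C_comp,
      Polynomial.X_comp]
    rw [← mul_assoc, ← Polynomial.C_mul, Ring.mul_inverse_cancel _ hy, Polynomial.C_1]
    ring
  have hσ : σ (q.eval x) = Ideal.Quotient.mk _ (q.comp ℓ) := by
    have h1 : σ x = Ideal.Quotient.mk _ ℓ := by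
      rw [hx]
      simp only [ℓ, map_add, map_mul]
      rfl
    rw [Polynomial.eval_eq_sum, Polynomial.comp, Polynomial.eval₂_eq_sum, Polynomial.sum,
      Polynomial.sum, map_sum, map_sum]
    refine Finset.sum_congr rfl fun k _ => ?_
    rw [map_mul, map_pow, hq, h1, map_mul, map_pow]
    rfl
  -- The hypothesis on `σ` gives the coefficients below `N`; from `N` on both sides vanish because
  -- `q.comp ℓ` has degree below `N`.
  have hcomp : q.comp ℓ = Polynomial.C (q.eval x) := by
    rw [hσ, algebraMap_trunc, ← sub_eq_zero, ← map_sub, truncMk_eq_zero_iff] at ha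
    ext d
    rcases Nat.lt_or_ge d N with hd | hd
    · have := ha d hd
      rwa [Polynomial.coeff_sub, sub_eq_zero] at this
    · rw [Polynomial.coeff_C_of_ne_zero (by omega)]
      refine Polynomial.coeff_eq_zero_of_natDegree_lt ?_
      have hℓdeg : ℓ.natDegree ≤ 1 := by
        simp only [ℓ]
        compute_degree
      have hqdeg : q.natDegree < N := by
        rcases eq_or_ne q 0 with rfl | h0
        · simpa using hN
        · exact (Polynomial.natDegree_lt_iff_degree_lt h0).2 hdeg
      calc (q.comp ℓ).natDegree ≤ q.natDegree * ℓ.natDegree := Polynomial.natDegree_comp_le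
        _ ≤ q.natDegree * 1 := Nat.mul_le_mul_left _ hℓdeg
        _ < d := by omega
  have := congrArg (fun r : Polynomial S => r.comp ℓ') hcomp
  simpa only [Polynomial.comp_assoc, hℓ, Polynomial.comp_X, Polynomial.C_comp] using this

/-! ### Equality of the two subalgebras. -/

section Coinvariants

variable {R : Type*} [CommRing R] (lam : R) {N : ℕ}

lemma ringInverse_mem_coinvariants {a : SA lam N} (ha : IsUnit a) (h : a ∈ coinvariants lam N) :
    Ring.inverse a ∈ coinvariants lam N := by
  rw [mem_coinvariants_iff] at h ⊢
  have h1 := map_ringInverse (truncCoaction lam N).toRingHom ha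
  have h2 := map_ringInverse (algebraMap (SA lam N) (TruncPoly (SA lam N) N)) ha
  exact h1.trans ((congrArg _ h).trans h2.symm)

lemma X_zero_mem_coinvariants (hN0 : 0 < N) : X lam N 0 ∈ coinvariants lam N :=
  (mem_coinvariants_iff lam N _).2 (truncCoaction_X_zero lam N hN0)

/-- Numerator and denominator are both scaled by `(1 + λT)^s`. -/
lemma Y_div_mem_coinvariants (hN1 : 1 < N) {s : ℕ} (hs : s < N) :
    Y lam N s * Ring.inverse (Y lam N 1 ^ s) ∈ coinvariants lam N := by
  have hu := (isUnit_Y lam N hN1).pow s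
  set b := Y lam N s * Ring.inverse (Y lam N 1 ^ s) with hb
  have h : b * Y lam N 1 ^ s = Y lam N s := by
    rw [hb, mul_assoc, Ring.inverse_mul_cancel _ hu, mul_one]
  have h1 := congrArg (truncCoaction lam N) h
  have huu : IsUnit (1 + algebraMap R (TruncPoly (SA lam N) N) lam * truncT (SA lam N) N) := by
    rw [one_add_truncT_eq]
    exact isUnit_one_add_truncT N _
  rw [map_mul, map_pow, truncCoaction_Y lam N hN1, truncCoaction_Y lam N hs, pow_one, mul_pow,
    ← mul_assoc, (huu.pow s).mul_left_inj, ← map_pow] at h1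
  rw [mem_coinvariants_iff, ← (hu.map (algebraMap _ (TruncPoly (SA lam N) N))).mul_left_inj, h1,
    ← map_mul, h]

section Char

variable (hN1 : 1 < N) (hN : ∀ k, 0 < k → k < N → (N.choose k : R) = 0)

include hN1 hN

lemma Y_one_pow : X lam N 0 ^ N + algebraMap R (SA lam N) (lam ^ N) * X lam N 1 ^ N =
    Y lam N 1 ^ N := by
  rw [Y_one, add_pow_of_choose_eq_zero (by omega) (choose_cast_eq_zero N hN), mul_pow, map_pow]

/-- `(X 1 + Y 1 · T)^N = (X 1)^N`, by additivity of the `N`-th power and `T^N = 0`. -/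
lemma X_one_pow_mem_coinvariants : X lam N 1 ^ N ∈ coinvariants lam N := by
  rw [mem_coinvariants_iff, map_pow, truncCoaction_X_one lam N hN1,
    add_pow_of_choose_eq_zero (by omega) (choose_cast_eq_zero N hN), mul_pow, truncT_pow_self,
    mul_zero, add_zero, map_pow]

lemma generated_le_coinvariants : generated lam N ≤ coinvariants lam N := by
  refine Algebra.adjoin_le ?_
  have hN0 : 0 < N := by omega
  have hX0 := X_zero_mem_coinvariants lam hN0
  have hX1 := X_one_pow_mem_coinvariants lam hN1 hN
  rintro x ((hx | ⟨s, hs, hsN, rfl⟩) | ⟨s, hs, hsN, rfl⟩)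
  · rcases hx with rfl | rfl | rfl | rfl
    · exact hX0
    · refine ringInverse_mem_coinvariants lam ?_ hX0
      rw [← Y_zero]
      exact isUnit_Y lam N hN0
    · exact hX1
    · refine ringInverse_mem_coinvariants lam ?_
        (add_mem (pow_mem hX0 N) (mul_mem (Subalgebra.algebraMap_mem _ _) hX1))
      rw [Y_one_pow lam hN1 hN]
      exact (isUnit_Y lam N hN1).pow N
  · rw [P_eq_recP lam hN0 hN hs hsN]
    exact recP_mem_coinvariants lam N hN1 hN hsN
  · rw [← Y_one]
    exact Y_div_mem_coinvariants lam hN1 hsN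

lemma recP_mem_generated {s : ℕ} (hs : s ≤ N) : recP lam N s ∈ generated lam N := by
  have hu := isUnit_Y lam N (show 0 < N by omega)
  rcases Nat.lt_or_ge s 2 with h | h
  · interval_cases s
    · rw [recP_zero lam hu]
      exact one_mem _
    · rw [recP_one lam hu]
      exact zero_mem _
  · rw [← P_eq_recP lam (by omega) hN h hs]
    exact Algebra.subset_adjoin (.inl (.inr ⟨s, h, hs, rfl⟩))

/-- With `X 1` in `E`, so are `Y 1` and its inverse `(Y 1)^(N-1) / (Y 1)^N`. The quotient generators
then give `Y s`, `Y_mul_sum_recP` gives `1 / Y s`, and the recursion for `recP` gives the `X s` by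
induction, so `E` contains all variables and `1/Δ`. -/
lemma generated_closure_eq_top (E : Subalgebra R (SA lam N)) (hE : generated lam N ≤ E)
    (hX1 : X lam N 1 ∈ E) : E = ⊤ := by
  have hN0 : 0 < N := by omega
  have hX0 : X lam N 0 ∈ E := hE (Algebra.subset_adjoin (.inl (.inl (.inl rfl))))
  have hX0' : Ring.inverse (X lam N 0) ∈ E :=
    hE (Algebra.subset_adjoin (.inl (.inl (.inr (.inl rfl)))))
  have hYN : Ring.inverse (Y lam N 1 ^ N) ∈ E := by
    rw [← Y_one_pow lam hN1 hN]
    exact hE (Algebra.subset_adjoin (.inl (.inl (.inr (.inr (.inr rfl))))))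
  have hY1 : Y lam N 1 ∈ E := by
    rw [Y_one]
    exact add_mem hX0 (mul_mem (Subalgebra.algebraMap_mem _ _) hX1)
  have huY (s : ℕ) (hs : s < N) : IsUnit (Y lam N s) := isUnit_Y lam N hs
  have hu0 : IsUnit (X lam N 0) := Y_zero lam N ▸ huY 0 hN0
  have hY1' : Ring.inverse (Y lam N 1) ∈ E := by
    have : Ring.inverse (Y lam N 1) = Y lam N 1 ^ (N - 1) * Ring.inverse (Y lam N 1 ^ N) := by
      rw [Ring.eq_mul_inverse_iff_mul_eq _ _ _ ((huY 1 hN1).pow N)]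
      rw [← mul_pow_sub_one hN0.ne' (Y lam N 1), ← mul_assoc,
        Ring.inverse_mul_cancel _ (huY 1 hN1), one_mul]
    rw [this]
    exact mul_mem (pow_mem hY1 _) hYN
  have hrec (s : ℕ) (hs : s ≤ N) : recP lam N s ∈ E := hE (recP_mem_generated lam hN1 hN hs)
  have hsum (s : ℕ) (hs : s ≤ N) : ∑ k ∈ Finset.range (s + 1), (s.choose k : SA lam N) *
      algebraMap R (SA lam N) (lam ^ k) * X lam N 0 ^ (s - k) * recP lam N k ∈ E := by
    refine sum_mem fun k hk => ?_
    have hk := Finset.mem_range.1 hk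
    exact mul_mem (mul_mem (mul_mem (natCast_mem _ _) (Subalgebra.algebraMap_mem _ _))
      (pow_mem hX0 _)) (hrec k (by omega))
  have hmul (s : ℕ) (hs : s ≤ N) := Y_mul_sum_recP lam s
    fun m hm => isUnit_Y_of_le lam N hN0 hN (hm.trans hs)
  have hYinv (s : ℕ) (hs : s < N) : Ring.inverse (Y lam N s) ∈ E := by
    have : Ring.inverse (Y lam N s) = (∑ k ∈ Finset.range (s + 1), (s.choose k : SA lam N) *
        algebraMap R (SA lam N) (lam ^ k) * X lam N 0 ^ (s - k) * recP lam N k) *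
          Ring.inverse (X lam N 0) * Ring.inverse (Y lam N 1) ^ s := by
      have h := hmul s hs.le
      have h1 := Ring.inverse_mul_cancel _ (huY s hs)
      have h2 := Ring.mul_inverse_cancel _ hu0
      have h3 : Y lam N 1 ^ s * Ring.inverse (Y lam N 1) ^ s = 1 := by
        rw [← mul_pow, Ring.mul_inverse_cancel _ (huY 1 hN1), one_pow]
      linear_combination (-(Ring.inverse (Y lam N s))) * h3 -
        Ring.inverse (Y lam N s) * Y lam N 1 ^ s * Ring.inverse (Y lam N 1) ^ s * h2 -
        Ring.inverse (Y lam N s) * Ring.inverse (X lam N 0) * Ring.inverse (Y lam N 1) ^ s * h +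
        (∑ k ∈ Finset.range (s + 1), (s.choose k : SA lam N) *
        algebraMap R (SA lam N) (lam ^ k) * X lam N 0 ^ (s - k) * recP lam N k) *
          Ring.inverse (X lam N 0) * Ring.inverse (Y lam N 1) ^ s * h1
    rw [this]
    exact mul_mem (mul_mem (hsum s hs.le) hX0') (pow_mem hY1' _)
  have hY (s : ℕ) (hs : 2 ≤ s) (hsN : s < N) : Y lam N s ∈ E := by
    have h : Y lam N s * Ring.inverse ((X lam N 0 + algebraMap R (SA lam N) lam * X lam N 1) ^ s)
      ∈ E := hE (Algebra.subset_adjoin (.inr ⟨s, hs, hsN, rfl⟩))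
    rw [← Y_one] at h
    have h2 := mul_mem h (pow_mem hY1 s)
    rwa [mul_assoc, Ring.inverse_mul_cancel _ ((huY 1 hN1).pow s), mul_one] at h2
  have hX (s : ℕ) (hs : s < N) : X lam N s ∈ E := by
    induction s using Nat.strong_induction_on with
    | _ s ih =>
      have hXc (j : ℕ) (hj : j < s) : X lam N j ∈ E := ih j hj (hj.trans hs)
      -- isolate the coefficient of `X_{T^s}` in the recursion
      have h := sum_recP_mul_shiftY lam (huY s hs)
      have hsplit : ∀ i ∈ Finset.range (s + 1), (s.choose i : SA lam N) * X lam N 0 ^ (s - i) *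
          recP lam N i * shiftY lam N i (s - i) =
          (s.choose i : SA lam N) * X lam N 0 ^ (s - i) * recP lam N i *
            (∑ j ∈ Finset.range i, (i.choose j : SA lam N) * algebraMap R (SA lam N) (lam ^ j) *
              X lam N (j + (s - i))) +
          ((s.choose i : SA lam N) * algebraMap R (SA lam N) (lam ^ i) * X lam N 0 ^ (s - i) *
            recP lam N i) * X lam N s := by
        intro i hi
        have hi := Finset.mem_range.1 hi
        rw [shiftY, Finset.sum_range_succ, Nat.choose_self, Nat.cast_one, one_mul,
          show i + (s - i) = s by omega]
        ring
      rw [Finset.sum_congr rfl hsplit, Finset.sum_add_distrib, ← Finset.sum_mul] at h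
      have hlow : ∑ i ∈ Finset.range (s + 1), (s.choose i : SA lam N) * X lam N 0 ^ (s - i) *
          recP lam N i * (∑ j ∈ Finset.range i, (i.choose j : SA lam N) *
            algebraMap R (SA lam N) (lam ^ j) * X lam N (j + (s - i))) ∈ E := by
        refine sum_mem fun i hi => ?_
        have hi := Finset.mem_range.1 hi
        refine mul_mem (mul_mem (mul_mem (natCast_mem _ _) (pow_mem hX0 _)) (hrec i (by omega)))
          (sum_mem fun j hj => ?_)
        have hj := Finset.mem_range.1 hj
        exact mul_mem (mul_mem (natCast_mem _ _) (Subalgebra.algebraMap_mem _ _))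
          (hXc _ (by omega))
      have hYs : Y lam N s ∈ E := by
        rcases Nat.lt_or_ge s 2 with h2 | h2
        · interval_cases s
          · rw [Y_zero]
            exact hX0
          · exact hY1
        · exact hY s h2 hs
      have hm := hmul s hs.le
      have h2 := Ring.mul_inverse_cancel _ hu0
      have h3 : Y lam N 1 ^ s * Ring.inverse (Y lam N 1) ^ s = 1 := by
        rw [← mul_pow, Ring.mul_inverse_cancel _ (huY 1 hN1), one_pow]
      generalize ∑ i ∈ Finset.range (s + 1), (s.choose i : SA lam N) * X lam N 0 ^ (s - i) *
          recP lam N i * (∑ j ∈ Finset.range i, (i.choose j : SA lam N) *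
            algebraMap R (SA lam N) (lam ^ j) * X lam N (j + (s - i))) = Q at *
      -- By `hm` the coefficient of `X s` in `h` is `X 0 * Y 1 ^ s / Y s`, whose inverse lies in
      -- `E`.
      have hXs : X lam N s = Y lam N s * Ring.inverse (X lam N 0) * Ring.inverse (Y lam N 1) ^ s *
          (X lam N 0 * X lam N 1 ^ s - Q) := by
        linear_combination Y lam N s * Ring.inverse (X lam N 0) * Ring.inverse (Y lam N 1) ^ s * h -
          Ring.inverse (X lam N 0) * Ring.inverse (Y lam N 1) ^ s * X lam N s * hm -
          Y lam N 1 ^ s * Ring.inverse (Y lam N 1) ^ s * X lam N s * h2 - X lam N s * h3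
      rw [hXs]
      exact mul_mem (mul_mem (mul_mem hYs hX0') (pow_mem hY1' _))
        (sub_mem (mul_mem hX0 (pow_mem hX1 _)) hlow)
  have hpoly (q : MvPolynomial (Fin N) R) : algebraMap _ (SA lam N) q ∈ E := by
    induction q using MvPolynomial.induction_on with
    | C r =>
      rw [← MvPolynomial.algebraMap_eq, ← IsScalarTower.algebraMap_apply]
      exact Subalgebra.algebraMap_mem _ _
    | add a b ha hb =>
      rw [map_add]
      exact add_mem ha hb
    | mul_X a i ha =>
      rw [map_mul]
      refine mul_mem ha ?_
      have := hX i i.2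
      simpa [X, polyX] using this
  have hdisc : Ring.inverse (algebraMap _ (SA lam N) (disc lam N)) ∈ E := by
    have hd : algebraMap _ (SA lam N) (disc lam N) = ∏ l ∈ Finset.range N, Y lam N l := by
      refine (congrArg (algebraMap _ (SA lam N)) (disc_eq lam N)).trans ?_
      simp only [map_prod, algebraMap_polyY]
    have : Ring.inverse (algebraMap _ (SA lam N) (disc lam N)) =
        ∏ l ∈ Finset.range N, Ring.inverse (Y lam N l) := by
      refine ((isUnit_disc lam N).mul_right_inj).1 ?_
      rw [Ring.mul_inverse_cancel _ (isUnit_disc lam N), hd,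
        ← Finset.prod_mul_distrib, Finset.prod_eq_one]
      intro l hl
      rw [Ring.mul_inverse_cancel _ (huY l (Finset.mem_range.1 hl))]
    rw [this]
    exact prod_mem fun l hl => hYinv l (Finset.mem_range.1 hl)
  refine eq_top_iff.2 fun a _ => ?_
  obtain ⟨⟨x, ⟨_, m, rfl⟩⟩, hx⟩ := IsLocalization.surj (Submonoid.powers (disc lam N)) a
  have hx : a * algebraMap _ (SA lam N) (disc lam N) ^ m = algebraMap _ _ x := by
    rw [← map_pow]
    exact hx
  have ha : a = algebraMap _ _ x * Ring.inverse (algebraMap _ (SA lam N) (disc lam N)) ^ m := by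
    rw [← hx, mul_assoc, ← mul_pow, Ring.mul_inverse_cancel _ (isUnit_disc lam N), one_pow, mul_one]
  rw [ha]
  exact mul_mem (hpoly x) (pow_mem hdisc m)

lemma exists_polynomial_eval_X_one (a : SA lam N) :
    ∃ q : Polynomial (SA lam N), (∀ k, q.coeff k ∈ generated lam N) ∧ q.degree < N ∧
      q.eval (X lam N 1) = a := by
  exact exists_polynomial_of_forall_eq_top (by omega)
    (Algebra.subset_adjoin (.inl (.inl (.inr (.inr (.inl rfl))))))
    (generated_closure_eq_top lam hN1 hN) a

lemma coinvariants_le_generated : coinvariants lam N ≤ generated lam N := by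
  intro a ha
  obtain ⟨q, hq, hdeg, rfl⟩ := exists_polynomial_eval_X_one lam hN1 hN a
  have h := eq_C_of_truncPoly_hom (truncCoaction lam N).toRingHom (by omega) (isUnit_Y lam N hN1)
    (truncCoaction_X_one lam N hN1) hdeg
    (fun k => (mem_coinvariants_iff lam N _).1 (generated_le_coinvariants lam hN1 hN (hq k)))
    ((mem_coinvariants_iff lam N _).1 ha)
  -- `q` is constant, so the given element is its coefficient at 0, which lies in `generated`.
  have h0 := hq 0
  rw [h, Polynomial.coeff_C_zero] at h0
  exact h0

end Char

end Coinvariants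

end

end UnitGroupScheme

theorem proposition3p5 (p : ℕ) [Fact p.Prime] (n : ℕ) (hn : 0 < n)
    (R : Type*) [CommRing R] [Algebra (ZMod p) R] (lam : R) :
    (∀ s, 2 ≤ s → s ≤ p ^ n → ∃! q : UnitGroupScheme.SAPoly R (p ^ n),
      UnitGroupScheme.toSALaurent R (p ^ n) q = UnitGroupScheme.laurentP R (p ^ n) s) ∧
    UnitGroupScheme.coinvariants lam (p ^ n) = UnitGroupScheme.generated lam (p ^ n) := by
  have hp : p.Prime := Fact.out
  have hN1 : 1 < p ^ n := Nat.one_lt_pow hn.ne' hp.one_lt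
  -- Characteristic `p` enters the argument only through these vanishing binomials.
  have hN : ∀ k, 0 < k → k < p ^ n → ((p ^ n).choose k : R) = 0 := by
    intro k hk hkN
    rw [← map_natCast (algebraMap (ZMod p) R), (ZMod.natCast_eq_zero_iff _ _).2
      (hp.dvd_choose_pow hk.ne' hkN.ne), map_zero]
  refine ⟨fun s hs hsN => ?_, le_antisymm
    (UnitGroupScheme.coinvariants_le_generated lam hN1 hN)
    (UnitGroupScheme.generated_le_coinvariants lam hN1 hN)⟩
  have h := UnitGroupScheme.toSALaurent_recP_eq_laurentP R (by omega) hN hs hsN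
  exact ⟨_, h, fun q hq => UnitGroupScheme.toSALaurent_injective R (hq.trans h.symm)⟩
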